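/- Let $\mathbb R^{4,1}$ be $\mathbb R^5$ with an inner product $(\cdot,\cdot)$ of signature $(4,1)$, let $S^{3,1}=\{s : (s,s)=1\}$ and $\mathcal L=\{x\neq 0 : (x,x)=0\}$, and fix $q\in S^{3,1}$. Hyperbolic space (two copies of it, with common ideal boundary given by the sphere $q$) is $K^3=\{x\in\mathcal L : (x,q)=-1\}$. Let $\Sigma^2$ be a smooth surface (a $2$-manifold). A *horosphere congruence* is a smooth map $s:\Sigma^2\to S^{3,1}$ with $(s,q)=-1$ and $s\neq -q$ everywhere, i.e. $s=h-q$ with $h:\Sigma^2\to\mathcal L\cap q^\perp$; it is *regular* if its induced metric $(ds,ds)$ is positive definite (equivalently, non-degenerate). A map $F:\Sigma^2\to\mathcal L$ *envelops* $s$ if $(F,s)=0$ and $(dF,s)=0$. A *surface in hyperbolic space* is given by smooth maps $f:\Sigma^2\to K^3$ and $t:\Sigma^2\to S^{3,1}\cap q^\perp$ (its tangent plane map) with $(f,t)=0$, $(df,t)=0$ and $(df,dt)$ injective at every point (a front: $f$ itself may have singularities). Its *hyperbolic Gauss map* is $h=q+f+t$. Its principal curvatures $k_1,k_2\in\mathbb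 R\cup\{\infty\}$, $k_i=a_i/b_i$, are given by Rodrigues' equations $b_i\,dt(X_i)+a_i\,df(X_i)=0$, $(a_i,b_i)\ne(0,0)$, for a basis $X_1,X_2$ of the tangent space. The surface is *linear Weingarten of Bryant type with parameter* $\mu\in\mathbb R$ if $$0=(\mu+1)\,K-2\mu\,H+(\mu-1),\qquad K=k_1k_2,\quad 2H=k_1+k_2,$$ where at singular points of $f$ the equation is understood in homogeneous form, $0=(\mu+1)\,a_1a_2-\mu\,(a_1b_2+a_2b_1)+(\mu-1)\,b_1b_2$. **Theorem.** Let $s:\Sigma^2\to S^{3,1}$ be a regular horosphere congruence and $\mu\in\mathbb R$. Then the induced metric of $s$ has constant (intrinsic) Gauss curvature $K_{(ds,ds)}=-\mu$ if and only if $s$ is enveloped by a linear Weingarten surface $f$ of Bryant type with parameter $\mu$ and by its hyperbolic Gauss map $h$. -/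

import Mathlib

open scoped Manifold ContDiff

noncomputable section

/-! ### The ambient space `ℝ^{4,1}` and its quadrics -/

/-- The vector space underlying `ℝ^{4,1}`; the norm it carries is used for its topology only. -/
abbrev R41 : Type := EuclideanSpace ℝ (Fin 5)

/-- The model space of surfaces. -/
abbrev Plane : Type := EuclideanSpace ℝ (Fin 2)

/-- The inner product of signature `(4,1)`. -/
def lor (x y : R41) : ℝ :=
  x 0 * y 0 + x 1 * y 1 + x 2 * y 2 + x 3 * y 3 - x 4 * y 4

/-- The de Sitter space `S^{3,1}` of oriented spheres. -/
def deSitter : Set R41 := {s | lor s s = 1}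

/-- The light cone, whose projectivization is the conformal `3`-sphere. -/
def lightCone : Set R41 := {x | x ≠ 0 ∧ lor x x = 0}

/-- Hyperbolic space (two copies of it, bounded by the `2`-sphere `q`) as the section `(x, q) = -1`
of the light cone. -/
def hypSpace (q : R41) : Set R41 := {x | x ∈ lightCone ∧ lor x q = -1}

/-- The horospheres, oriented so that they touch `-q`: the spheres `s = h - q` where `h` is a
nonzero isotropic vector orthogonal to `q`. The condition `s ≠ -q` says `h ≠ 0`. -/
def horospheres (q : R41) : Set R41 := {s | s ∈ deSitter ∧ lor s q = -1 ∧ s ≠ -q}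

/-! ### Intrinsic Gauss curvature of a metric in coordinates -/

/-- The `i`-th partial derivative of a map on the coordinate plane. -/
def pd {E : Type*} [NormedAddCommGroup E] [NormedSpace ℝ E]
    (i : Fin 2) (F : Plane → E) (y : Plane) : E :=
  fderiv ℝ F y (EuclideanSpace.single i 1)

/-- Christoffel symbols of the first kind, `[ij,k] = (∂ᵢ gⱼₖ + ∂ⱼ gᵢₖ - ∂ₖ gᵢⱼ) / 2`. -/
def christoffel (g : Fin 2 → Fin 2 → Plane → ℝ) (i j k : Fin 2) (y : Plane) : ℝ :=
  (pd i (g j k) y + pd j (g i k) y - pd k (g i j) y) / 2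

/-- The component `R₁₂₁₂` of the covariant curvature tensor of the metric `∑ gᵢⱼ dyⁱ dyʲ`, with the
sign for which round spheres have positive curvature:
`R₁₂₁₂ = (2 ∂₁∂₂ g₁₂ - ∂₂∂₂ g₁₁ - ∂₁∂₁ g₂₂) / 2 + ∑ gᵐⁿ ([12,m] [12,n] - [11,m] [22,n])`. -/
def riemann1212 (g : Fin 2 → Fin 2 → Plane → ℝ) (y : Plane) : ℝ :=
  (2 * pd 0 (pd 1 (g 0 1)) y - pd 1 (pd 1 (g 0 0)) y - pd 0 (pd 0 (g 1 1)) y) / 2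
    + ∑ m : Fin 2, ∑ n : Fin 2, (Matrix.of fun i j => g i j y)⁻¹ m n *
        (christoffel g 0 1 m y * christoffel g 0 1 n y
          - christoffel g 0 0 m y * christoffel g 1 1 n y)

/-- The (intrinsic) Gauss curvature of the metric `∑ gᵢⱼ dyⁱ dyʲ`. -/
def gaussCurvatureCoord (g : Fin 2 → Fin 2 → Plane → ℝ) (y : Plane) : ℝ :=
  riemann1212 g y / (Matrix.of fun i j => g i j y).det

/-- The coefficients `(∂ᵢ S, ∂ⱼ S)` of the metric induced by a map on the coordinate plane. -/
def metricCoeff (S : Plane → R41) (i j : Fin 2) (y : Plane) : ℝ :=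
  lor (pd i S y) (pd j S y)

section Surfaces

variable {M : Type*} [TopologicalSpace M] [ChartedSpace Plane M]

/-- The differential `T_x M → ℝ^{4,1}` of a map into `ℝ^{4,1}`. -/
def diffAt (F : M → R41) (x : M) : TangentSpace 𝓘(ℝ, Plane) x →L[ℝ] R41 :=
  mfderiv 𝓘(ℝ, Plane) 𝓘(ℝ, R41) F x

/-- The Gauss curvature at `x` of the induced metric `(ds, ds)`, computed in the preferred chart
at `x` (where the metric is positive definite, any other chart around `x` gives the same value). -/
def gaussCurvature (s : M → R41) (x : M) : ℝ :=
  gaussCurvatureCoord (metricCoeff (s ∘ (chartAt Plane x).symm)) (chartAt Plane x x)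

/-! ### Horosphere congruences, fronts in hyperbolic space, envelopes -/

/-- A smooth `2`-parameter family of horospheres. -/
structure IsHorosphereCongruence (q : R41) (s : M → R41) : Prop where
  smooth : ContMDiff 𝓘(ℝ, Plane) 𝓘(ℝ, R41) ∞ s
  mem : ∀ x, s x ∈ horospheres q

/-- The induced metric `(ds, ds)` is positive definite. For a horosphere congruence it is always
positive semidefinite, so this says that it is non-degenerate (and `s` is then an immersion). -/
def IsRegularCongruence (s : M → R41) : Prop :=
  ∀ (x : M) (X : TangentSpace 𝓘(ℝ, Plane) x), X ≠ 0 → 0 < lor (diffAt s x X) (diffAt s x X)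

/-- A surface in hyperbolic space, given by its hyperbolic lift `f` and its tangent plane map `t`,
in the sense of Legendre immersions: `f` may have singularities, but `(df, dt)` is injective. -/
structure IsHyperbolicFront (q : R41) (f t : M → R41) : Prop where
  smooth_lift : ContMDiff 𝓘(ℝ, Plane) 𝓘(ℝ, R41) ∞ f
  smooth_normal : ContMDiff 𝓘(ℝ, Plane) 𝓘(ℝ, R41) ∞ t
  lift_mem : ∀ x, f x ∈ hypSpace q
  normal_mem : ∀ x, t x ∈ deSitter
  normal_orth : ∀ x, lor (t x) q = 0
  incident : ∀ x, lor (f x) (t x) = 0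
  contact : ∀ (x : M) (X : TangentSpace 𝓘(ℝ, Plane) x), lor (diffAt f x X) (t x) = 0
  immersive : ∀ (x : M) (X : TangentSpace 𝓘(ℝ, Plane) x),
    diffAt f x X = 0 → diffAt t x X = 0 → X = 0

/-- The hyperbolic Gauss map `h = q + f + t` of a surface in hyperbolic space. -/
def hypGaussMap (q : R41) (f t : M → R41) : M → R41 := fun x => q + f x + t x

/-- The point map `⟨F⟩` envelops the sphere congruence `s`: `F, dF ⊥ s`. -/
structure Envelops (F s : M → R41) : Prop where
  isotropic : ∀ x, F x ∈ lightCone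
  incident : ∀ x, lor (F x) (s x) = 0
  tangent : ∀ (x : M) (X : TangentSpace 𝓘(ℝ, Plane) x), lor (diffAt F x X) (s x) = 0

/-! ### Curvatures of fronts and the Bryant type condition -/

/-- `X` is a principal direction at `x` with principal curvature `a / b ∈ ℝ ∪ {∞}` in homogeneous
form: Rodrigues' equation `b dt(X) + a df(X) = 0`. At immersed points of `f` one has `b ≠ 0`. -/
def IsPrincipal (f t : M → R41) (x : M) (X : TangentSpace 𝓘(ℝ, Plane) x) (a b : ℝ) : Prop :=
  (a ≠ 0 ∨ b ≠ 0) ∧ b • diffAt t x X + a • diffAt f x X = 0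

/-- The relation `0 = (μ+1) K - 2 μ H + (μ-1)` at `x` between `K = k₁ k₂` and `2 H = k₁ + k₂`, where
`k₁ = a₁ / b₁` and `k₂ = a₂ / b₂` are the principal curvatures; it is multiplied by `b₁ b₂` so as
to make sense at singular points of `f` as well. -/
def IsBryantAt (μ : ℝ) (f t : M → R41) (x : M) : Prop :=
  ∃ (X₁ X₂ : TangentSpace 𝓘(ℝ, Plane) x) (a₁ b₁ a₂ b₂ : ℝ),
    LinearIndependent ℝ ![X₁, X₂] ∧ IsPrincipal f t x X₁ a₁ b₁ ∧ IsPrincipal f t x X₂ a₂ b₂ ∧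
      (μ + 1) * (a₁ * a₂) - μ * (a₁ * b₂ + a₂ * b₁) + (μ - 1) * (b₁ * b₂) = 0

/-- Linear Weingarten surfaces of Bryant type with parameter `μ`. -/
def IsBryantType (μ : ℝ) (f t : M → R41) : Prop := ∀ x, IsBryantAt μ f t x

/-- `H` and `K` are the mean and the extrinsic Gauss curvature of `f` at `x`. -/
def HasMeanGaussCurvature (f t : M → R41) (x : M) (H K : ℝ) : Prop :=
  ∃ (X₁ X₂ : TangentSpace 𝓘(ℝ, Plane) x) (k₁ k₂ : ℝ),
    LinearIndependent ℝ ![X₁, X₂] ∧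
      diffAt t x X₁ + k₁ • diffAt f x X₁ = 0 ∧ diffAt t x X₂ + k₂ • diffAt f x X₂ = 0 ∧
      H = (k₁ + k₂) / 2 ∧ K = k₁ * k₂

/-- At points where `f` is an immersion, the Bryant type condition is the usual relation between
the mean and Gauss curvatures. -/
theorem isBryantAt_iff (μ : ℝ) (f t : M → R41) (x : M)
    (hf : Function.Injective (diffAt f x)) :
    IsBryantAt μ f t x ↔ ∃ H K : ℝ, HasMeanGaussCurvature f t x H K ∧
      (μ + 1) * K - 2 * μ * H + (μ - 1) = 0 := by
  have key : ∀ (X : TangentSpace 𝓘(ℝ, Plane) x) (a b : ℝ), X ≠ 0 → IsPrincipal f t x X a b →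
      b ≠ 0 ∧ diffAt t x X + (a / b) • diffAt f x X = 0 := by
    rintro X a b hX ⟨hab, h⟩
    have hb : b ≠ 0 := by
      rintro rfl
      have ha : a ≠ 0 := by simpa using hab
      rw [zero_smul, zero_add, smul_eq_zero] at h
      exact hX (hf (by simpa [ha] using h))
    refine ⟨hb, ?_⟩
    have h2 : b⁻¹ • (b • diffAt t x X + a • diffAt f x X) = 0 := by rw [h, smul_zero]
    rw [smul_add, smul_smul, smul_smul, inv_mul_cancel₀ hb, one_smul] at h2
    rwa [div_eq_inv_mul]
  constructor
  · rintro ⟨X₁, X₂, a₁, b₁, a₂, b₂, hli, h1, h2, he⟩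
    obtain ⟨hb1, h1⟩ := key X₁ a₁ b₁ (by simpa using hli.ne_zero 0) h1
    obtain ⟨hb2, h2⟩ := key X₂ a₂ b₂ (by simpa using hli.ne_zero 1) h2
    refine ⟨_, _, ⟨X₁, X₂, a₁ / b₁, a₂ / b₂, hli, h1, h2, rfl, rfl⟩, ?_⟩
    field_simp
    linear_combination he
  · rintro ⟨H, K, ⟨X₁, X₂, k₁, k₂, hli, h1, h2, rfl, rfl⟩, he⟩
    refine ⟨X₁, X₂, k₁, 1, k₂, 1, hli, ⟨by simp, by simpa using h1⟩, ⟨by simp, by simpa using h2⟩, ?_⟩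
    linear_combination he

end Surfaces

end

noncomputable section

/-! ### Algebra of the inner product -/

/-! Put `h = s + q`. From `(s, s) = (q, q) = 1` and `(s, q) = -1` it follows that `h` is null and,
like `s`, orthogonal to `ds`. The normal bundle of the immersion `s` is therefore spanned by `s`,
`h` and one further null field `f`, fixed by `(f, s) = 0` and `(f, h) = -1`. Then `(f, q) = -1`, and
`t = s - f` is a tangent plane map for `f` with `q + f + t = h`. Conversely, the envelope conditions
force any front as in the theorem to arise in this way.

What remains is pointwise. Since `df` is orthogonal to `s`, `h` and `f`, one has `df = ds ∘ A`, with
`A` self-adjoint for the induced metric `g`. The second derivatives of `s` have products `-g` with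
both `s` and `h`, and `-(ds, df)` with `f`, so the Gauss equation (`gaussCurvatureCoord_mul_det`)
gives `K = 1 - tr A`. On the other side `dt = ds ∘ (1 - A)`, so an eigenvalue `l` of `A` yields the
principal curvature `(l - 1) : l`. In terms of the two eigenvalues the Bryant relation loses its
quadratic part and becomes `tr A = μ + 1` (`exists_principal_iff_trace`). Both conditions thus say
`K = -μ`; they are joined in `isBryantAt_iff_gaussCurvature`. -/

theorem lor_comm (x y : R41) : lor x y = lor y x := by unfold lor; ring

theorem lor_add_left (x y z : R41) : lor (x + y) z = lor x z + lor y z := by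
  simp only [lor, PiLp.add_apply]; ring

theorem lor_add_right (x y z : R41) : lor x (y + z) = lor x y + lor x z := by
  simp only [lor, PiLp.add_apply]; ring

theorem lor_sub_left (x y z : R41) : lor (x - y) z = lor x z - lor y z := by
  simp only [lor, PiLp.sub_apply]; ring

theorem lor_sub_right (x y z : R41) : lor x (y - z) = lor x y - lor x z := by
  simp only [lor, PiLp.sub_apply]; ring

theorem lor_smul_left (c : ℝ) (x y : R41) : lor (c • x) y = c * lor x y := by
  simp only [lor, PiLp.smul_apply, smul_eq_mul]; ring

theorem lor_smul_right (c : ℝ) (x y : R41) : lor x (c • y) = c * lor x y := by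
  simp only [lor, PiLp.smul_apply, smul_eq_mul]; ring

theorem lor_zero_left (x : R41) : lor 0 x = 0 := by simp [lor]

theorem eq_zero_of_forall_lor {x : R41} (h : ∀ y, lor x y = 0) : x = 0 := by
  ext i
  have := h (EuclideanSpace.single i 1)
  fin_cases i <;> simpa [lor] using this

/-- The last standard basis vector, which is timelike. -/
def timeVec : R41 := EuclideanSpace.single 4 1

/-- If the time coordinate of a null vector vanishes, so does its positive definite spatial part.
This supplies the nonzero denominator in `conormal`. -/
theorem lor_timeVec_ne_zero {h : R41} (hh : h ∈ lightCone) : lor timeVec h ≠ 0 := by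
  obtain ⟨h0, hl⟩ := hh
  intro hz
  have h4 : h 4 = 0 := by simpa [lor, timeVec] using hz
  apply h0
  have hs : h 0 * h 0 + h 1 * h 1 + h 2 * h 2 + h 3 * h 3 = 0 := by
    simpa [lor, h4] using hl
  ext i
  fin_cases i <;> simp <;>
    nlinarith [mul_self_nonneg (h 0), mul_self_nonneg (h 1), mul_self_nonneg (h 2),
      mul_self_nonneg (h 3)]

/-! ### Frames adapted to a sphere congruence -/

/-- A sphere `s`, tangent vectors `u`, `v` and a null vector `h`, with the orthogonality relations
of a sphere congruence enveloped by `h`. -/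
structure IsTangentFrame (s u v h : R41) : Prop where
  ss : lor s s = 1
  su : lor s u = 0
  sv : lor s v = 0
  sh : lor s h = 0
  hu : lor h u = 0
  hv : lor h v = 0
  hh : lor h h = 0
  det : lor u u * lor v v - lor u v * lor u v ≠ 0

/-- `f` is the second null normal of a tangent frame. -/
structure IsConormal (s u v h f : R41) : Prop where
  fs : lor f s = 0
  fu : lor f u = 0
  fv : lor f v = 0
  ff : lor f f = 0
  fh : lor f h = -1

section Frame

variable {s u v h f : R41}

/-- The Gram matrix of the five vectors splits into `1`, the invertible block of `u, v`, and the
hyperbolic plane of `h, f`. They therefore form a basis, and `lor` is non-degenerate. -/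
theorem IsTangentFrame.eq_zero (F : IsTangentFrame s u v h) (C : IsConormal s u v h f) {x : R41}
    (xs : lor x s = 0) (xu : lor x u = 0) (xv : lor x v = 0) (xh : lor x h = 0)
    (xf : lor x f = 0) : x = 0 := by
  have hli : LinearIndependent ℝ ![s, u, v, h, f] := by
    rw [Fintype.linearIndependent_iff]
    intro c hc
    have key : ∀ y, c 0 * lor s y + c 1 * lor u y + c 2 * lor v y + c 3 * lor h y
        + c 4 * lor f y = 0 := by
      intro y
      have := congrArg (fun z => lor z y) hc
      simpa [Fin.sum_univ_five, lor_add_left, lor_smul_left, lor_zero_left] using this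
    have k0 := key s
    have k1 := key u
    have k2 := key v
    have k3 := key h
    have k4 := key f
    rw [lor_comm u s, lor_comm v s, lor_comm h s, F.ss, F.su, F.sv, F.sh, C.fs] at k0
    rw [lor_comm v u, F.su, F.hu, C.fu] at k1
    rw [F.sv, F.hv, C.fv] at k2
    rw [F.sh, lor_comm u h, lor_comm v h, F.hu, F.hv, F.hh, C.fh] at k3
    rw [lor_comm s f, lor_comm u f, lor_comm v f, lor_comm h f, C.fs, C.fu, C.fv, C.ff, C.fh] at k4
    have c1 : c 1 = 0 := by
      apply (mul_eq_zero.1 _).resolve_right F.det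
      linear_combination lor v v * k1 - lor u v * k2
    have c2 : c 2 = 0 := by
      apply (mul_eq_zero.1 _).resolve_right F.det
      linear_combination lor u u * k2 - lor u v * k1
    intro i
    fin_cases i
    · simpa using k0
    · exact c1
    · exact c2
    · simpa using k4
    · simpa using k3
  let b := basisOfLinearIndependentOfCardEqFinrank hli (by simp)
  let φ : R41 →ₗ[ℝ] ℝ :=
    { toFun := lor x
      map_add' := lor_add_right x
      map_smul' := fun c y => lor_smul_right c x y }
  have hφ : φ = 0 := by
    apply b.ext
    intro i
    fin_cases i <;> simp [b, φ, xs, xu, xv, xh, xf]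
  exact eq_zero_of_forall_lor fun y => LinearMap.congr_fun hφ y

theorem IsTangentFrame.expand (F : IsTangentFrame s u v h) (C : IsConormal s u v h f) (x : R41) :
    x = lor x s • s
      + ((lor v v * lor x u - lor u v * lor x v) / (lor u u * lor v v - lor u v * lor u v)) • u
      + ((lor u u * lor x v - lor u v * lor x u) / (lor u u * lor v v - lor u v * lor u v)) • v
      - lor x f • h - lor x h • f := by
  have hd := F.det
  obtain ⟨D, hD⟩ : ∃ D, D = lor u u * lor v v - lor u v * lor u v := ⟨_, rfl⟩
  rw [← hD] at hd ⊢
  rw [← sub_eq_zero]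
  apply F.eq_zero C <;>
    simp only [lor_add_left, lor_smul_left, lor_sub_left, F.ss, F.su, F.sv, F.sh, F.hu, F.hv, F.hh,
      C.fs, C.fu, C.fv, C.ff, C.fh, lor_comm u s, lor_comm v s, lor_comm h s, lor_comm u h,
      lor_comm v h, lor_comm s f, lor_comm u f, lor_comm v f, lor_comm h f, lor_comm v u] <;>
    field_simp <;> (try rw [hD]) <;> ring

theorem IsTangentFrame.lor_expand (F : IsTangentFrame s u v h) (C : IsConormal s u v h f)
    (x y : R41) :
    lor x y = lor x s * lor y s
      + ((lor v v * lor x u - lor u v * lor x v) / (lor u u * lor v v - lor u v * lor u v))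
        * lor y u
      + ((lor u u * lor x v - lor u v * lor x u) / (lor u u * lor v v - lor u v * lor u v))
        * lor y v
      - lor x f * lor y h - lor x h * lor y f := by
  have := congrArg (fun z => lor z y) (F.expand C x)
  simp only [lor_add_left, lor_smul_left, lor_sub_left] at this
  rw [this, lor_comm s y, lor_comm u y, lor_comm v y, lor_comm f y, lor_comm h y]

/-- Expanding in the frame gives `f' = f - (f', f) h`, hence `(f', f') = 2 (f', f)`; nullity of `f'`
kills the correction. -/
theorem IsTangentFrame.conormal_unique (F : IsTangentFrame s u v h) (C : IsConormal s u v h f)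
    {f' : R41} (C' : IsConormal s u v h f') : f' = f := by
  have e := F.expand C f'
  simp only [C'.fs, C'.fu, C'.fv, C'.fh, mul_zero, sub_zero, zero_div, zero_smul, zero_add,
    zero_sub, neg_smul, one_smul, sub_neg_eq_add] at e
  have h1 : lor f' f = 0 := by
    have h2 : lor f' f' = 2 * lor f' f := by
      nth_rewrite 1 2 [e]
      simp only [lor_add_left, lor_add_right, ← neg_smul, lor_smul_left, lor_smul_right,
        F.hh, C.ff, C.fh, lor_comm h f]
      ring
    rw [C'.ff] at h2
    linarith
  simpa [h1] using e

/-- The component of `timeVec` orthogonal to `s`, `u`, `v`. -/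
def normalPart (s u v : R41) : R41 :=
  timeVec - lor timeVec s • s
    - ((lor v v * lor timeVec u - lor u v * lor timeVec v)
        / (lor u u * lor v v - lor u v * lor u v)) • u
    - ((lor u u * lor timeVec v - lor u v * lor timeVec u)
        / (lor u u * lor v v - lor u v * lor u v)) • v

/-- The second null normal of a tangent frame. -/
def conormal (s u v h : R41) : R41 :=
  (lor (normalPart s u v) (normalPart s u v) / (2 * lor timeVec h ^ 2)) • h
    - (lor timeVec h)⁻¹ • normalPart s u v

/-- Rescaling the normal part of `timeVec` achieves product `-1` with `h`; adding a multiple of `h`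
then corrects the square to zero and leaves the other products unchanged. -/
theorem IsTangentFrame.isConormal_conormal (F : IsTangentFrame s u v h) (h0 : h ≠ 0) :
    IsConormal s u v h (conormal s u v h) := by
  have hd := F.det
  obtain ⟨D, hD⟩ : ∃ D, D = lor u u * lor v v - lor u v * lor u v := ⟨_, rfl⟩
  rw [← hD] at hd
  have he : lor timeVec h ≠ 0 := lor_timeVec_ne_zero ⟨h0, F.hh⟩
  have ws : lor (normalPart s u v) s = 0 := by
    simp only [normalPart, lor_smul_left, lor_sub_left, F.ss, F.su, F.sv, lor_comm u s,
      lor_comm v s]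
    ring
  have wu : lor (normalPart s u v) u = 0 := by
    simp only [normalPart, lor_smul_left, lor_sub_left, F.su, lor_comm v u]
    rw [← hD]
    field_simp
    rw [hD]
    ring
  have wv : lor (normalPart s u v) v = 0 := by
    simp only [normalPart, lor_smul_left, lor_sub_left, F.sv]
    rw [← hD]
    field_simp
    rw [hD]
    ring
  have wh : lor (normalPart s u v) h = lor timeVec h := by
    simp only [normalPart, lor_smul_left, lor_sub_left, F.sh, lor_comm u h, lor_comm v h, F.hu,
      F.hv]
    ring
  constructor
  · simp [conormal, lor_sub_left, lor_smul_left, ws, lor_comm h s, F.sh]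
  · simp [conormal, lor_sub_left, lor_smul_left, wu, F.hu]
  · simp [conormal, lor_sub_left, lor_smul_left, wv, F.hv]
  · simp only [conormal, lor_sub_left, lor_smul_left, lor_sub_right, lor_smul_right, F.hh,
      lor_comm h (normalPart s u v), wh]
    field_simp
    ring
  · simp only [conormal, lor_sub_left, lor_smul_left, F.hh, wh]
    field_simp
    ring

end Frame

/-! ### Principal directions and the trace of the shape operator -/

/-- If `N = L ∘ A` with `L` injective and `A` self-adjoint for a positive definite form `g`, then
the Bryant condition for `N` and `L - N` is a condition on the trace of `A`. -/
theorem exists_principal_iff_trace (L N T : Plane →L[ℝ] R41) (hL : Function.Injective L)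
    (hT : T = L - N) (a b c d g₀ g₁ g₂ μ : ℝ)
    (hN : ∀ X, N X = (a * X 0 + b * X 1) • L (EuclideanSpace.single 0 1)
      + (c * X 0 + d * X 1) • L (EuclideanSpace.single 1 1))
    (hLX : ∀ X, L X = X 0 • L (EuclideanSpace.single 0 1) + X 1 • L (EuclideanSpace.single 1 1))
    (hg : 0 < g₀) (hdet : 0 < g₀ * g₂ - g₁ * g₁)
    (hsymm : b * g₀ + d * g₁ = a * g₁ + c * g₂) :
    (∃ (X₁ X₂ : Plane) (a₁ b₁ a₂ b₂ : ℝ), LinearIndependent ℝ ![X₁, X₂] ∧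
      ((a₁ ≠ 0 ∨ b₁ ≠ 0) ∧ b₁ • T X₁ + a₁ • N X₁ = 0) ∧
      ((a₂ ≠ 0 ∨ b₂ ≠ 0) ∧ b₂ • T X₂ + a₂ • N X₂ = 0) ∧
      (μ + 1) * (a₁ * a₂) - μ * (a₁ * b₂ + a₂ * b₁) + (μ - 1) * (b₁ * b₂) = 0) ↔
    a + d = μ + 1 := by
  have eig : ∀ (X : Plane) (l : ℝ), N X = l • L X ↔
      a * X 0 + b * X 1 = l * X 0 ∧ c * X 0 + d * X 1 = l * X 1 := by
    intro X l
    have hNL : N X = L (!₂[a * X 0 + b * X 1, c * X 0 + d * X 1]) := by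
      rw [hN, hLX !₂[_, _]]; simp
    rw [hNL, ← map_smul, hL.eq_iff]
    constructor
    · intro e
      exact ⟨by simpa using congrArg (fun Y : Plane => Y 0) e,
        by simpa using congrArg (fun Y : Plane => Y 1) e⟩
    · rintro ⟨e0, e1⟩
      ext i
      fin_cases i
      · simpa using e0
      · simpa using e1
  have li : ∀ X Y : Plane, LinearIndependent ℝ ![X, Y] ↔ X 0 * Y 1 - X 1 * Y 0 ≠ 0 := by
    intro X Y
    rw [LinearIndependent.pair_iff]
    constructor
    · intro h hz
      have h1 := h (Y 1) (-X 1) (by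
        ext i; fin_cases i <;> simp <;> linarith)
      have h2 := h (Y 0) (-X 0) (by
        ext i; fin_cases i <;> simp <;> linarith)
      have h3 := h 1 0 (by
        ext i; fin_cases i <;> simp
        · linarith [h2.2]
        · linarith [h1.2])
      exact one_ne_zero h3.1
    · intro h p r e
      have e0 : p * X 0 + r * Y 0 = 0 := by simpa using congrArg (fun Y : Plane => Y 0) e
      have e1 : p * X 1 + r * Y 1 = 0 := by simpa using congrArg (fun Y : Plane => Y 1) e
      constructor
      · apply (mul_eq_zero.1 _).resolve_right h
        linear_combination Y 1 * e0 - Y 0 * e1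
      · apply (mul_eq_zero.1 _).resolve_right h
        linear_combination X 0 * e1 - X 1 * e0
  subst hT
  constructor
  · rintro ⟨X, Y, a₁, b₁, a₂, b₂, hli, h1, h2, he⟩
    have key : ∀ (X : Plane) (a b : ℝ), X ≠ 0 →
        ((a ≠ 0 ∨ b ≠ 0) ∧ b • (L - N) X + a • N X = 0) →
        b - a ≠ 0 ∧ N X = (b / (b - a)) • L X := by
      rintro X a b hX ⟨hab, h⟩
      -- Rodrigues' equation for `T = L - N`; it exhibits `b / (b - a)` as an eigenvalue.
      have h' : b • L X = (b - a) • N X := by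
        rw [← sub_eq_zero, ← h, sub_apply]; module
      have hne : b - a ≠ 0 := by
        intro h0
        rw [h0, zero_smul, smul_eq_zero] at h'
        have hb : b = 0 := h'.resolve_right fun h => hX (hL (by simpa using h))
        have ha : a = 0 := by linarith
        simp [ha, hb] at hab
      refine ⟨hne, ?_⟩
      rw [div_eq_inv_mul, mul_smul, h', smul_smul, inv_mul_cancel₀ hne, one_smul]
    obtain ⟨n1, e1⟩ := key X a₁ b₁ (by simpa using hli.ne_zero 0) h1
    obtain ⟨n2, e2⟩ := key Y a₂ b₂ (by simpa using hli.ne_zero 1) h2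
    rw [eig] at e1 e2
    -- The identity `det(AX, Y) + det(X, AY) = tr A · det(X, Y)`.
    have hsum : a + d = b₁ / (b₁ - a₁) + b₂ / (b₂ - a₂) := by
      apply mul_right_cancel₀ ((li X Y).1 hli)
      linear_combination Y 1 * e1.1 - Y 0 * e1.2 + X 0 * e2.2 - X 1 * e2.1
    rw [hsum]
    field_simp
    linear_combination -he
  · intro htr
    -- Any eigenbasis suffices: the eigenvalue `l` gives the pair `(l - 1, l)`, never `(0, 0)`, and
    -- the terms in `l * m` cancel from the Bryant relation.
    have suff : ∀ (X Y : Plane) (l m : ℝ), X 0 * Y 1 - X 1 * Y 0 ≠ 0 → l + m = a + d →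
        (a * X 0 + b * X 1 = l * X 0 ∧ c * X 0 + d * X 1 = l * X 1) →
        (a * Y 0 + b * Y 1 = m * Y 0 ∧ c * Y 0 + d * Y 1 = m * Y 1) →
        ∃ (X₁ X₂ : Plane) (a₁ b₁ a₂ b₂ : ℝ), LinearIndependent ℝ ![X₁, X₂] ∧
          ((a₁ ≠ 0 ∨ b₁ ≠ 0) ∧ b₁ • (L - N) X₁ + a₁ • N X₁ = 0) ∧
          ((a₂ ≠ 0 ∨ b₂ ≠ 0) ∧ b₂ • (L - N) X₂ + a₂ • N X₂ = 0) ∧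
          (μ + 1) * (a₁ * a₂) - μ * (a₁ * b₂ + a₂ * b₁) + (μ - 1) * (b₁ * b₂) = 0 := by
      intro X Y l m hXY hlm hX hY
      rw [← eig] at hX hY
      have nz : ∀ r : ℝ, r - 1 ≠ 0 ∨ r ≠ 0 := by
        intro r
        by_contra! h
        linarith [h.1, h.2]
      refine ⟨X, Y, l - 1, l, m - 1, m, (li X Y).2 hXY, ⟨nz l, ?_⟩, ⟨nz m, ?_⟩, ?_⟩
      · rw [sub_apply, hX]; module
      · rw [sub_apply, hY]; module
      · linear_combination -htr - hlm
    by_cases hc : c = 0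
    · subst hc
      -- Triangular case: a double eigenvalue would allow a Jordan block, which self-adjointness
      -- excludes.
      by_cases had : a - d = 0
      · have hb : b = 0 := by
          apply (mul_eq_zero.1 _).resolve_right hg.ne'
          linear_combination hsymm + g₁ * had
        have : d = a := by linarith
        subst hb this
        exact suff !₂[1, 0] !₂[0, 1] d d (by simp) rfl (by simp) (by simp)
      · refine suff !₂[1, 0] !₂[-b, a - d] a d (by simpa using had) rfl (by simp) ⟨?_, ?_⟩
        · simp; ring
        · simp
    -- Self-adjointness eliminates `b`, and completing the square writes `g₀ ^ 2` times the
    -- discriminant as a square plus `4 * c ^ 2` times the determinant of `g`.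
    · have hdisc : 0 < (a - d) ^ 2 + 4 * (b * c) := by
        have h1 : 0 < g₀ * (g₀ * ((a - d) ^ 2 + 4 * (b * c))) := by
          have : g₀ * (g₀ * ((a - d) ^ 2 + 4 * (b * c))) =
              (g₀ * (a - d) + 2 * g₁ * c) ^ 2 + (g₀ * g₂ - g₁ * g₁) * (4 * c ^ 2) := by
            linear_combination 4 * g₀ * c * hsymm
          rw [this]
          positivity
        exact pos_of_mul_pos_right (pos_of_mul_pos_right h1 hg.le) hg.le
      have hr := Real.sqrt_pos.2 hdisc
      have hr2 := Real.mul_self_sqrt hdisc.le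
      set r := Real.sqrt ((a - d) ^ 2 + 4 * (b * c))
      -- For `c ≠ 0` the vector `(l - d, c)` is an eigenvector for the eigenvalue `l`.
      refine suff !₂[(a + d + r) / 2 - d, c] !₂[(a + d - r) / 2 - d, c] ((a + d + r) / 2)
        ((a + d - r) / 2) ?_ (by ring) ⟨?_, ?_⟩ ⟨?_, ?_⟩
      · have : r * c ≠ 0 := mul_ne_zero hr.ne' hc
        intro h0
        apply this
        simp at h0
        linear_combination h0
      · simp; linear_combination -hr2 / 4
      · simp; ring
      · simp; linear_combination -hr2 / 4
      · simp; ring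

/-! ### Partial derivatives in the coordinate plane -/

/-- The inner product as a continuous bilinear map. -/
def lorBilin : R41 →L[ℝ] R41 →L[ℝ] ℝ :=
  (LinearMap.mk₂ ℝ lor lor_add_left lor_smul_left lor_add_right
    lor_smul_right).toContinuousBilinearMap

theorem lorBilin_apply (x y : R41) : lorBilin x y = lor x y := rfl

theorem ContDiffAt.lor {n : ℕ∞ω} {F G : Plane → R41} {y : Plane} (hF : ContDiffAt ℝ n F y)
    (hG : ContDiffAt ℝ n G y) : ContDiffAt ℝ n (fun z => lor (F z) (G z)) y :=
  (lorBilin.contDiff.contDiffAt.comp y hF).clm_apply hG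

theorem fderiv_lor {F G : Plane → R41} {y : Plane} (hF : DifferentiableAt ℝ F y)
    (hG : DifferentiableAt ℝ G y) (X : Plane) :
    fderiv ℝ (fun z => lor (F z) (G z)) y X
      = lor (fderiv ℝ F y X) (G y) + lor (F y) (fderiv ℝ G y X) := by
  have := (lorBilin.hasFDerivAt_of_bilinear hF.hasFDerivAt hG.hasFDerivAt).fderiv
  simp only [lorBilin_apply] at this
  rw [this]
  simp [lorBilin_apply, add_comm]

theorem pd_lor {F G : Plane → R41} {y : Plane} (hF : DifferentiableAt ℝ F y)
    (hG : DifferentiableAt ℝ G y) (i : Fin 2) :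
    pd i (fun z => lor (F z) (G z)) y = lor (pd i F y) (G y) + lor (F y) (pd i G y) :=
  fderiv_lor hF hG _

section Open

variable {E : Type*} [NormedAddCommGroup E] [NormedSpace ℝ E] {U : Set Plane}

theorem pd_congr (hU : IsOpen U) {F G : Plane → E} (h : ∀ y ∈ U, F y = G y) (i : Fin 2)
    {y : Plane} (hy : y ∈ U) : pd i F y = pd i G y := by
  have : F =ᶠ[nhds y] G := Filter.eventually_of_mem (hU.mem_nhds hy) h
  simp only [pd, this.fderiv_eq]

theorem pd_eq_zero (hU : IsOpen U) {F : Plane → E} {c : E} (h : ∀ y ∈ U, F y = c) (i : Fin 2)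
    {y : Plane} (hy : y ∈ U) : pd i F y = 0 := by
  rw [pd_congr hU h i hy]
  simp [pd]

theorem contDiffOn_pd (hU : IsOpen U) {F : Plane → E} (hF : ContDiffOn ℝ ∞ F U) (i : Fin 2) :
    ContDiffOn ℝ ∞ (pd i F) U :=
  (hF.fderiv_of_isOpen hU (m := ∞) (by simp)).clm_apply contDiffOn_const

theorem differentiableAt_of_contDiffOn (hU : IsOpen U) {F : Plane → E} (hF : ContDiffOn ℝ ∞ F U)
    {y : Plane} (hy : y ∈ U) : DifferentiableAt ℝ F y :=
  (hF.contDiffAt (hU.mem_nhds hy)).differentiableAt (by simp)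

theorem pd_comm (hU : IsOpen U) {F : Plane → E} (hF : ContDiffOn ℝ ∞ F U) (i j : Fin 2)
    {y : Plane} (hy : y ∈ U) : pd i (pd j F) y = pd j (pd i F) y := by
  have hd : DifferentiableAt ℝ (fderiv ℝ F) y :=
    differentiableAt_of_contDiffOn hU (hF.fderiv_of_isOpen hU (m := ∞) (by simp)) hy
  have key : ∀ i j : Fin 2, pd i (pd j F) y =
      fderiv ℝ (fderiv ℝ F) y (EuclideanSpace.single i 1) (EuclideanSpace.single j 1) := by
    intro i j
    change fderiv ℝ (fun z => fderiv ℝ F z (EuclideanSpace.single j 1)) y _ = _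
    rw [fderiv_clm_apply hd (differentiableAt_const _)]
    simp
  rw [key, key]
  exact (hF.contDiffAt (hU.mem_nhds hy)).isSymmSndFDerivAt
    (by rw [minSmoothness_of_isRCLikeNormedField]; exact ENat.LEInfty.out) _ _

end Open

/-! ### The Gauss equation -/

section Gauss

variable {U : Set Plane} {S : Plane → R41}

theorem pd_metricCoeff (hU : IsOpen U) (hS : ContDiffOn ℝ ∞ S U) (i j k : Fin 2) {y : Plane}
    (hy : y ∈ U) : pd k (metricCoeff S i j) y =
      lor (pd k (pd i S) y) (pd j S y) + lor (pd i S y) (pd k (pd j S) y) :=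
  pd_lor (differentiableAt_of_contDiffOn hU (contDiffOn_pd hU hS i) hy)
    (differentiableAt_of_contDiffOn hU (contDiffOn_pd hU hS j) hy) k

theorem christoffel_metricCoeff (hU : IsOpen U) (hS : ContDiffOn ℝ ∞ S U) (i j k : Fin 2)
    {y : Plane} (hy : y ∈ U) :
    christoffel (metricCoeff S) i j k y = lor (pd i (pd j S) y) (pd k S y) := by
  simp only [christoffel, pd_metricCoeff hU hS _ _ _ hy]
  rw [pd_comm hU hS j i hy, pd_comm hU hS k i hy, pd_comm hU hS k j hy,
    lor_comm (pd j S y), lor_comm (pd i S y)]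
  ring

theorem pd_pd_metricCoeff (hU : IsOpen U) (hS : ContDiffOn ℝ ∞ S U) (i j k l : Fin 2) {y : Plane}
    (hy : y ∈ U) : pd l (pd k (metricCoeff S i j)) y =
      lor (pd l (pd k (pd i S)) y) (pd j S y) + lor (pd k (pd i S) y) (pd l (pd j S) y) +
      (lor (pd l (pd i S) y) (pd k (pd j S) y) + lor (pd i S y) (pd l (pd k (pd j S)) y)) := by
  have d1 := fun m => differentiableAt_of_contDiffOn hU (contDiffOn_pd hU hS m) hy
  have d2 := fun m => differentiableAt_of_contDiffOn hU
    (contDiffOn_pd hU (contDiffOn_pd hU hS m) k) hy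
  rw [pd_congr hU (fun z hz => pd_metricCoeff hU hS i j k hz) l hy, ← pd_lor (d2 i) (d1 j),
    ← pd_lor (d1 i) (d2 j)]
  have e1 := ((contDiffOn_pd hU (contDiffOn_pd hU hS i) k).contDiffAt (hU.mem_nhds hy)).lor
    ((contDiffOn_pd hU hS j).contDiffAt (hU.mem_nhds hy))
  have e2 := ((contDiffOn_pd hU hS i).contDiffAt (hU.mem_nhds hy)).lor
    ((contDiffOn_pd hU (contDiffOn_pd hU hS j) k).contDiffAt (hU.mem_nhds hy))
  simp only [pd]
  exact congrArg (fun T : Plane →L[ℝ] ℝ => T (EuclideanSpace.single l 1))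
    (fderiv_add (e1.differentiableAt (by simp)) (e2.differentiableAt (by simp)))

/-- All third derivatives of `S` cancel once partial derivatives are commuted. -/
theorem second_derivs_metricCoeff (hU : IsOpen U) (hS : ContDiffOn ℝ ∞ S U) {y : Plane}
    (hy : y ∈ U) :
    (2 * pd 0 (pd 1 (metricCoeff S 0 1)) y - pd 1 (pd 1 (metricCoeff S 0 0)) y
        - pd 0 (pd 0 (metricCoeff S 1 1)) y) / 2
      = lor (pd 0 (pd 0 S) y) (pd 1 (pd 1 S) y) - lor (pd 0 (pd 1 S) y) (pd 0 (pd 1 S) y) := by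
  simp only [pd_pd_metricCoeff hU hS _ _ _ _ hy]
  have c1 : pd 1 (pd 1 (pd 0 S)) y = pd 0 (pd 1 (pd 1 S)) y := by
    rw [pd_congr hU (fun z hz => pd_comm hU hS 1 0 hz) 1 hy,
      pd_comm hU (contDiffOn_pd hU hS 1) 1 0 hy]
  have c2 : pd 0 (pd 1 (pd 0 S)) y = pd 0 (pd 0 (pd 1 S)) y :=
    pd_congr hU (fun z hz => pd_comm hU hS 1 0 hz) 0 hy
  rw [c1, c2, pd_comm hU hS 1 0 hy, lor_comm (pd 1 S y), lor_comm _ (pd 0 S y)]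
  ring

variable {q : R41} {f : Plane → R41}

theorem isTangentFrame_pd (hU : IsOpen U) (hS : ContDiffOn ℝ ∞ S U) (hqq : lor q q = 1)
    (hSS : ∀ y ∈ U, lor (S y) (S y) = 1) (hSq : ∀ y ∈ U, lor (S y) q = -1) {y : Plane} (hy : y ∈ U)
    (hdet : metricCoeff S 0 0 y * metricCoeff S 1 1 y
      - metricCoeff S 0 1 y * metricCoeff S 0 1 y ≠ 0) :
    IsTangentFrame (S y) (pd 0 S y) (pd 1 S y) (S y + q) := by
  have dS := differentiableAt_of_contDiffOn hU hS hy
  have a : ∀ i, lor (S y) (pd i S y) = 0 := by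
    intro i
    have := pd_eq_zero hU hSS i hy
    rw [pd_lor dS dS, lor_comm] at this
    linarith
  have b : ∀ i, lor q (pd i S y) = 0 := by
    intro i
    have := pd_eq_zero hU hSq i hy
    rw [pd_lor dS (differentiableAt_const q)] at this
    rw [lor_comm]
    simpa [pd, lor_comm (S y), lor_zero_left] using this
  constructor
  · exact hSS y hy
  · exact a 0
  · exact a 1
  · rw [lor_add_right, hSS y hy, hSq y hy]; ring
  · rw [lor_add_left, a, b]; ring
  · rw [lor_add_left, a, b]; ring
  · rw [lor_add_left, lor_add_right, lor_add_right, lor_comm q, hSS y hy, hSq y hy, hqq]; ring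
  · exact hdet

/-- Both sides equal `-(∂₀∂₁S, f)`. This is the self-adjointness of `A` in `df = ds ∘ A`. -/
theorem lor_pd_normal_symm (hU : IsOpen U) (hS : ContDiffOn ℝ ∞ S U) (hf : ContDiffOn ℝ ∞ f U)
    (hfS : ∀ i, ∀ y ∈ U, lor (pd i S y) (f y) = 0) {y : Plane} (hy : y ∈ U) :
    lor (pd 0 S y) (pd 1 f y) = lor (pd 1 S y) (pd 0 f y) := by
  have iif : ∀ i j, lor (pd i (pd j S) y) (f y) = - lor (pd j S y) (pd i f y) := by
    intro i j
    have := pd_eq_zero hU (hfS j) i hy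
    rw [pd_lor (differentiableAt_of_contDiffOn hU (contDiffOn_pd hU hS j) hy)
      (differentiableAt_of_contDiffOn hU hf hy)] at this
    linarith
  have := iif 1 0
  rw [pd_comm hU hS 1 0 hy, iif 0 1] at this
  linarith

/-- The Gauss equation for the surface `S` in `ℝ^{4,1}` with normal bundle spanned by `S` and the
null vectors `S + q` and `f`. -/
theorem gaussCurvatureCoord_mul_det (hU : IsOpen U) (hS : ContDiffOn ℝ ∞ S U)
    (hf : ContDiffOn ℝ ∞ f U)
    (hSS : ∀ y ∈ U, lor (S y) (S y) = 1) (hSq : ∀ y ∈ U, lor (S y) q = -1)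
    (hfS : ∀ i, ∀ y ∈ U, lor (pd i S y) (f y) = 0) {y : Plane} (hy : y ∈ U)
    (F : IsTangentFrame (S y) (pd 0 S y) (pd 1 S y) (S y + q))
    (C : IsConormal (S y) (pd 0 S y) (pd 1 S y) (S y + q) (f y)) :
    gaussCurvatureCoord (metricCoeff S) y * (metricCoeff S 0 0 y * metricCoeff S 1 1 y
      - metricCoeff S 0 1 y * metricCoeff S 0 1 y)
    = (metricCoeff S 0 0 y * metricCoeff S 1 1 y - metricCoeff S 0 1 y * metricCoeff S 0 1 y)
      - (lor (pd 0 S y) (pd 0 f y) * metricCoeff S 1 1 y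
        + lor (pd 1 S y) (pd 1 f y) * metricCoeff S 0 0 y
        - (lor (pd 0 S y) (pd 1 f y) + lor (pd 1 S y) (pd 0 f y)) * metricCoeff S 0 1 y) := by
  have dS := fun {z} (hz : z ∈ U) => differentiableAt_of_contDiffOn hU hS hz
  have dSi := fun i {z} (hz : z ∈ U) =>
    differentiableAt_of_contDiffOn hU (contDiffOn_pd hU hS i) hz
  have df := differentiableAt_of_contDiffOn hU hf hy
  have a : ∀ i, ∀ z ∈ U, lor (pd i S z) (S z) = 0 := by
    intro i z hz
    have := pd_eq_zero hU hSS i hz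
    rw [pd_lor (dS hz) (dS hz), lor_comm (S z)] at this
    linarith
  have b : ∀ i, ∀ z ∈ U, lor (pd i S z) q = 0 := by
    intro i z hz
    have := pd_eq_zero hU hSq i hz
    rw [pd_lor (dS hz) (differentiableAt_const q)] at this
    simpa [pd, lor_comm (S z), lor_zero_left] using this
  have iiS : ∀ i j, lor (pd i (pd j S) y) (S y) = - metricCoeff S j i y := by
    intro i j
    have := pd_eq_zero hU (a j) i hy
    rw [pd_lor (dSi j hy) (dS hy)] at this
    simp only [metricCoeff]
    linarith
  have iiq : ∀ i j, lor (pd i (pd j S) y) q = 0 := by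
    intro i j
    have := pd_eq_zero hU (b j) i hy
    rw [pd_lor (dSi j hy) (differentiableAt_const q)] at this
    simpa [pd, lor_comm _ (0 : R41), lor_zero_left] using this
  have iif : ∀ i j, lor (pd i (pd j S) y) (f y) = - lor (pd j S y) (pd i f y) := by
    intro i j
    have := pd_eq_zero hU (hfS j) i hy
    rw [pd_lor (dSi j hy) df] at this
    linarith
  have g10 : metricCoeff S 1 0 y = metricCoeff S 0 1 y := lor_comm _ _
  -- The tangential parts of these two products cancel against the Christoffel terms of
  -- `riemann1212`, leaving only products of normal components.
  have e1 := F.lor_expand C (pd 0 (pd 0 S) y) (pd 1 (pd 1 S) y)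
  have e2 := F.lor_expand C (pd 0 (pd 1 S) y) (pd 0 (pd 1 S) y)
  simp only [lor_add_right, iiS, iiq, iif, add_zero, g10] at e1 e2
  have hdet := F.det
  simp only [gaussCurvatureCoord, riemann1212, second_derivs_metricCoeff hU hS hy,
    christoffel_metricCoeff hU hS _ _ _ hy, Matrix.inv_def, Matrix.det_fin_two,
    Matrix.adjugate_fin_two, Fin.sum_univ_two, Ring.inverse_eq_inv', Matrix.smul_apply,
    Matrix.of_apply, g10, smul_eq_mul, e1, e2, Matrix.cons_val_zero, Matrix.cons_val_one,
    Matrix.cons_val_fin_one]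
  change metricCoeff S 0 0 y * metricCoeff S 1 1 y
      - metricCoeff S 0 1 y * metricCoeff S 0 1 y ≠ 0 at hdet
  rw [div_mul_cancel₀ _ hdet]
  simp only [show ∀ i j, lor (pd i S y) (pd j S y) = metricCoeff S i j y from fun _ _ => rfl]
  rw [lor_pd_normal_symm hU hS hf hfS hy]
  obtain ⟨D, hD⟩ : ∃ D, D = metricCoeff S 0 0 y * metricCoeff S 1 1 y
      - metricCoeff S 0 1 y * metricCoeff S 0 1 y := ⟨_, rfl⟩
  rw [← hD] at hdet ⊢
  field_simp
  rw [hD]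
  ring

end Gauss

section Manifold

variable {M : Type*} [TopologicalSpace M] [ChartedSpace Plane M]

/-! ### Differentials in charts -/

theorem diffAt_eq_fderiv {F : M → R41} (hF : ContMDiff 𝓘(ℝ, Plane) 𝓘(ℝ, R41) ∞ F) (x : M) :
    diffAt F x = fderiv ℝ (F ∘ (chartAt Plane x).symm) (chartAt Plane x x) := by
  have h := (hF x).mdifferentiableAt (by simp)
  refine h.mfderiv.trans ?_
  simp [writtenInExtChartAt, mfld_simps]
  rfl

theorem diffAt_single {F : M → R41} (hF : ContMDiff 𝓘(ℝ, Plane) 𝓘(ℝ, R41) ∞ F) (x : M)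
    (i : Fin 2) : diffAt F x (EuclideanSpace.single i 1 : Plane) =
      pd i (F ∘ (chartAt Plane x).symm) (chartAt Plane x x) := by
  rw [diffAt_eq_fderiv hF]; rfl

theorem diffAt_sub {F G : M → R41} (hF : ContMDiff 𝓘(ℝ, Plane) 𝓘(ℝ, R41) ∞ F)
    (hG : ContMDiff 𝓘(ℝ, Plane) 𝓘(ℝ, R41) ∞ G) (x : M) :
    diffAt (fun y => F y - G y) x = diffAt F x - diffAt G x :=
  mfderiv_sub ((hF x).mdifferentiableAt (by simp)) ((hG x).mdifferentiableAt (by simp))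

theorem diffAt_add_const {F : M → R41} (hF : ContMDiff 𝓘(ℝ, Plane) 𝓘(ℝ, R41) ∞ F) (c : R41)
    (x : M) : diffAt (fun y => F y + c) x = diffAt F x :=
  (mfderiv_add ((hF x).mdifferentiableAt (by simp)) (mdifferentiableAt_const (c := c))).trans
    (by rw [mfderiv_const]; exact add_zero _)

/-! ### The induced metric in charts -/

theorem linear_eq_smul_add (L : Plane →L[ℝ] R41) (X : Plane) :
    L X = X 0 • L (EuclideanSpace.single 0 1) + X 1 • L (EuclideanSpace.single 1 1) := by
  rw [← map_smul, ← map_smul, ← map_add]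
  congr 1
  ext i
  fin_cases i <;> simp

/-- The vector `(u, u) v - (u, v) u` has square `(u, u)` times the Gram determinant. -/
theorem gram_pos (L : Plane →L[ℝ] R41) (hL : ∀ X, X ≠ 0 → 0 < lor (L X) (L X)) (u v : R41)
    (hu : L (EuclideanSpace.single 0 1) = u) (hv : L (EuclideanSpace.single 1 1) = v) :
    0 < lor u u ∧ 0 < lor u u * lor v v - lor u v * lor u v := by
  have h0 : 0 < lor u u := hu ▸ hL _ (by simp)
  refine ⟨h0, ?_⟩
  have h1 := hL (lor u u • EuclideanSpace.single 1 1 - lor u v • EuclideanSpace.single 0 1) (by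
    intro h
    have := congrArg (fun Y : Plane => Y 1) h
    simp at this
    exact h0.ne' this)
  simp only [map_sub, map_smul, hu, hv, lor_sub_left, lor_sub_right, lor_smul_left,
    lor_smul_right, lor_comm v u] at h1
  refine pos_of_mul_pos_right (a := lor u u) ?_ h0.le
  linarith

variable {q : R41} {s : M → R41}

theorem metricCoeff_chart_pos (hs : IsHorosphereCongruence q s) (hreg : IsRegularCongruence s)
    (x : M) :
    0 < metricCoeff (s ∘ (chartAt Plane x).symm) 0 0 (chartAt Plane x x) ∧
    0 < metricCoeff (s ∘ (chartAt Plane x).symm) 0 0 (chartAt Plane x x) *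
        metricCoeff (s ∘ (chartAt Plane x).symm) 1 1 (chartAt Plane x x) -
      metricCoeff (s ∘ (chartAt Plane x).symm) 0 1 (chartAt Plane x x) *
        metricCoeff (s ∘ (chartAt Plane x).symm) 0 1 (chartAt Plane x x) :=
  gram_pos (diffAt s x) (hreg x) _ _ (diffAt_single hs.smooth x 0) (diffAt_single hs.smooth x 1)

theorem add_ne_zero_of_congruence (hs : IsHorosphereCongruence q s) (x : M) : s x + q ≠ 0 :=
  fun h => (hs.mem x).2.2 (eq_neg_of_add_eq_zero_left h)

variable [IsManifold 𝓘(ℝ, Plane) ∞ M]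

/-! ### Derivatives in charts away from the centre -/

theorem contDiffOn_comp_chart_symm {F : M → R41} (hF : ContMDiff 𝓘(ℝ, Plane) 𝓘(ℝ, R41) ∞ F)
    (x : M) : ContDiffOn ℝ ∞ (F ∘ (chartAt Plane x).symm) (chartAt Plane x).target :=
  contMDiffOn_iff_contDiffOn.1
    (hF.comp_contMDiffOn (contMDiffOn_chart_symm (I := 𝓘(ℝ, Plane)) (n := ∞) (x := x)))

/-- One vector `X` serves all maps `F`, so that pointwise conditions on differentials pass to
partial derivatives throughout one chart, where they can be differentiated again. -/
theorem exists_pd_chart_eq_diffAt (x : M) {z : Plane} (hz : z ∈ (chartAt Plane x).target)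
    (i : Fin 2) : ∃ X : TangentSpace 𝓘(ℝ, Plane) ((chartAt Plane x).symm z),
      ∀ F : M → R41, ContMDiff 𝓘(ℝ, Plane) 𝓘(ℝ, R41) ∞ F →
        pd i (F ∘ (chartAt Plane x).symm) z = diffAt F ((chartAt Plane x).symm z) X := by
  refine ⟨mfderiv 𝓘(ℝ, Plane) 𝓘(ℝ, Plane) (chartAt Plane x).symm z
    (EuclideanSpace.single i 1 : Plane), fun F hF => ?_⟩
  have h1 : MDifferentiableAt 𝓘(ℝ, Plane) 𝓘(ℝ, Plane) (chartAt Plane x).symm z :=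
    ((contMDiffOn_chart_symm (I := 𝓘(ℝ, Plane)) (n := ∞) (x := x)).contMDiffAt
      ((chartAt Plane x).open_target.mem_nhds hz)).mdifferentiableAt (by simp)
  have h2 := mfderiv_comp z ((hF ((chartAt Plane x).symm z)).mdifferentiableAt (by simp)) h1
  rw [mfderiv_eq_fderiv] at h2
  simp only [pd, h2]
  rfl

/-- The product rule for the inner product of two maps, when this inner product is constant. -/
theorem lor_diffAt_add {F G : M → R41} (hF : ContMDiff 𝓘(ℝ, Plane) 𝓘(ℝ, R41) ∞ F)
    (hG : ContMDiff 𝓘(ℝ, Plane) 𝓘(ℝ, R41) ∞ G) {c : ℝ} (h : ∀ x, lor (F x) (G x) = c) (x : M)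
    (X : TangentSpace 𝓘(ℝ, Plane) x) :
    lor (diffAt F x X) (G x) + lor (F x) (diffAt G x X) = 0 := by
  have hp := mem_chart_target Plane x
  have hU := (chartAt Plane x).open_target
  have := fderiv_lor (differentiableAt_of_contDiffOn hU (contDiffOn_comp_chart_symm hF x) hp)
    (differentiableAt_of_contDiffOn hU (contDiffOn_comp_chart_symm hG x) hp) X
  rw [diffAt_eq_fderiv hF, diffAt_eq_fderiv hG]
  simp only [Function.comp_apply, h, (chartAt Plane x).left_inv (mem_chart_source Plane x)] at this
  exact this.symm.trans (by simp; rfl)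

/-! ### The second envelope of a horosphere congruence -/

theorem isTangentFrame_chart (hq : q ∈ deSitter) (hs : IsHorosphereCongruence q s) (x : M)
    {z : Plane} (hz : z ∈ (chartAt Plane x).target)
    (hdet : metricCoeff (s ∘ (chartAt Plane x).symm) 0 0 z *
        metricCoeff (s ∘ (chartAt Plane x).symm) 1 1 z -
      metricCoeff (s ∘ (chartAt Plane x).symm) 0 1 z *
        metricCoeff (s ∘ (chartAt Plane x).symm) 0 1 z ≠ 0) :
    IsTangentFrame (s ((chartAt Plane x).symm z)) (pd 0 (s ∘ (chartAt Plane x).symm) z)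
      (pd 1 (s ∘ (chartAt Plane x).symm) z) (s ((chartAt Plane x).symm z) + q) :=
  isTangentFrame_pd (chartAt Plane x).open_target (contDiffOn_comp_chart_symm hs.smooth x) hq
    (fun _ _ => (hs.mem _).1) (fun _ _ => (hs.mem _).2.1) hz hdet

theorem isTangentFrame_diffAt (hq : q ∈ deSitter) (hs : IsHorosphereCongruence q s)
    (hreg : IsRegularCongruence s) (x : M) :
    IsTangentFrame (s x) (diffAt s x (EuclideanSpace.single 0 1 : Plane))
      (diffAt s x (EuclideanSpace.single 1 1 : Plane)) (s x + q) := by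
  rw [diffAt_single hs.smooth, diffAt_single hs.smooth]
  simpa only [(chartAt Plane x).left_inv (mem_chart_source Plane x)] using
    isTangentFrame_chart hq hs x (mem_chart_target Plane x) (metricCoeff_chart_pos hs hreg x).2.ne'

/-- `f` is the null normal field of `s` with `(f, s + q) = -1`. -/
structure IsConormalMap (q : R41) (s f : M → R41) : Prop where
  incident : ∀ x, lor (f x) (s x) = 0
  normal : ∀ (x : M) (X : TangentSpace 𝓘(ℝ, Plane) x), lor (f x) (diffAt s x X) = 0
  null : ∀ x, lor (f x) (f x) = 0
  scaled : ∀ x, lor (f x) (s x + q) = -1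

/-- The envelope of a horosphere congruence other than its hyperbolic Gauss map. -/
def conormalMap (q : R41) (s : M → R41) (x : M) : R41 :=
  conormal (s x) (diffAt s x (EuclideanSpace.single 0 1 : Plane))
    (diffAt s x (EuclideanSpace.single 1 1 : Plane)) (s x + q)

theorem isConormalMap_conormalMap (hq : q ∈ deSitter) (hs : IsHorosphereCongruence q s)
    (hreg : IsRegularCongruence s) : IsConormalMap q s (conormalMap q s) := by
  have C := fun x => (isTangentFrame_diffAt hq hs hreg x).isConormal_conormal
    (add_ne_zero_of_congruence hs x)
  refine ⟨fun x => (C x).fs, fun x X => ?_, fun x => (C x).ff, fun x => (C x).fh⟩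
  have e : diffAt s x X = _ := linear_eq_smul_add (diffAt s x) X
  rw [e, lor_add_right, lor_smul_right, lor_smul_right]
  have h1 := (C x).fu
  have h2 := (C x).fv
  unfold conormalMap
  refine Eq.trans (congrArg₂ (· + ·) (congrArg (_ * ·) h1) (congrArg (_ * ·) h2)) (by simp)

theorem IsConormalMap.isConormal {f : M → R41} (hf : IsConormalMap q s f)
    (hs : IsHorosphereCongruence q s) (x : M) {z : Plane} (hz : z ∈ (chartAt Plane x).target) :
    IsConormal (s ((chartAt Plane x).symm z)) (pd 0 (s ∘ (chartAt Plane x).symm) z)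
      (pd 1 (s ∘ (chartAt Plane x).symm) z) (s ((chartAt Plane x).symm z) + q)
      (f ((chartAt Plane x).symm z)) := by
  have key : ∀ i, lor (f ((chartAt Plane x).symm z)) (pd i (s ∘ (chartAt Plane x).symm) z) = 0 := by
    intro i
    obtain ⟨X, hX⟩ := exists_pd_chart_eq_diffAt x hz i
    rw [hX s hs.smooth]
    exact hf.normal _ X
  exact ⟨hf.incident _, key 0, key 1, hf.null _, hf.scaled _⟩

theorem contDiffAt_conormal {s u v h : Plane → R41} {z : Plane} (hs : ContDiffAt ℝ ∞ s z)
    (hu : ContDiffAt ℝ ∞ u z) (hv : ContDiffAt ℝ ∞ v z) (hh : ContDiffAt ℝ ∞ h z)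
    (hdet : lor (u z) (u z) * lor (v z) (v z) - lor (u z) (v z) * lor (u z) (v z) ≠ 0)
    (hl : h z ∈ lightCone) :
    ContDiffAt ℝ ∞ (fun y => conormal (s y) (u y) (v y) (h y)) z := by
  have he : ContDiffAt ℝ ∞ (fun _ : Plane => timeVec) z := contDiffAt_const
  have hD := ((hu.lor hu).mul (hv.lor hv)).sub ((hu.lor hv).mul (hu.lor hv))
  have hw : ContDiffAt ℝ ∞ (fun y => normalPart (s y) (u y) (v y)) z :=
    ((he.sub ((he.lor hs).smul hs)).sub
      (((((hv.lor hv).mul (he.lor hu)).sub ((hu.lor hv).mul (he.lor hv))).div hD hdet).smul hu)).sub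
      (((((hu.lor hu).mul (he.lor hv)).sub ((hu.lor hv).mul (he.lor hu))).div hD hdet).smul hv)
  have hne := lor_timeVec_ne_zero hl
  exact (((hw.lor hw).div (contDiffAt_const.mul ((he.lor hh).pow 2)) (by positivity)).smul hh).sub
    (((he.lor hh).inv hne).smul hw)

/-- The coordinate vectors in `conormalMap` come from a chart that changes with the point, so
smoothness is not visible from the formula. Near `x` it is compared with the conormal built in the
single chart at `x`. -/
theorem contMDiff_conormalMap (hq : q ∈ deSitter) (hs : IsHorosphereCongruence q s)
    (hreg : IsRegularCongruence s) :
    ContMDiff 𝓘(ℝ, Plane) 𝓘(ℝ, R41) ∞ (conormalMap q s) := by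
  intro x
  have hf := isConormalMap_conormalMap hq hs hreg
  set S := s ∘ (chartAt Plane x).symm with hSdef
  have hU := (chartAt Plane x).open_target
  have hp := mem_chart_target Plane x
  have hS := contDiffOn_comp_chart_symm hs.smooth x
  have cS := hS.contDiffAt (hU.mem_nhds hp)
  have cSi := fun i => (contDiffOn_pd hU hS i).contDiffAt (hU.mem_nhds hp)
  have hdet := (metricCoeff_chart_pos hs hreg x).2.ne'
  have hframe := isTangentFrame_chart hq hs x hp hdet
  have hG : ContDiffAt ℝ ∞ (fun z => conormal (S z) (pd 0 S z) (pd 1 S z) (S z + q))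
      (chartAt Plane x x) :=
    contDiffAt_conormal cS (cSi 0) (cSi 1) (cS.add contDiffAt_const) hdet
      ⟨add_ne_zero_of_congruence hs _, hframe.hh⟩
  have hcomp : ContMDiffAt 𝓘(ℝ, Plane) 𝓘(ℝ, R41) ∞
      ((fun z => conormal (S z) (pd 0 S z) (pd 1 S z) (S z + q)) ∘ chartAt Plane x) x :=
    hG.contMDiffAt.comp x (contMDiffAt_of_mem_maximalAtlas
      (IsManifold.chart_mem_maximalAtlas x) (mem_chart_source Plane x))
  refine hcomp.congr_of_eventuallyEq ?_
  have hdetC : ContinuousAt (fun z => metricCoeff S 0 0 z * metricCoeff S 1 1 z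
      - metricCoeff S 0 1 z * metricCoeff S 0 1 z) (chartAt Plane x x) :=
    ((((cSi 0).lor (cSi 0)).mul ((cSi 1).lor (cSi 1))).sub
      (((cSi 0).lor (cSi 1)).mul ((cSi 0).lor (cSi 1)))).continuousAt
  have hev := ((chartAt Plane x).continuousAt (mem_chart_source Plane x)).eventually
    (hdetC.eventually_ne hdet)
  filter_upwards [hev, (chartAt Plane x).open_source.mem_nhds (mem_chart_source Plane x)]
    with y hy hys
  have hz := (chartAt Plane x).map_source hys
  -- The second null normal does not depend on the basis of the tangent plane, so both constructions
  -- agree by uniqueness.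
  have F := isTangentFrame_chart hq hs x hz hy
  have := F.conormal_unique (F.isConormal_conormal (add_ne_zero_of_congruence hs _))
    (hf.isConormal hs x hz)
  rw [(chartAt Plane x).left_inv hys] at this
  simp only [Function.comp_apply, hSdef, (chartAt Plane x).left_inv hys]
  exact this

/-! ### Curvature of the congruence and of its envelope -/

theorem isBryantAt_iff_gaussCurvature (hq : q ∈ deSitter) (hs : IsHorosphereCongruence q s)
    (hreg : IsRegularCongruence s) {f t : M → R41}
    (hfs : ContMDiff 𝓘(ℝ, Plane) 𝓘(ℝ, R41) ∞ f) (hf : IsConormalMap q s f)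
    (ht : t = fun x => s x - f x) (μ : ℝ) (x : M) :
    IsBryantAt μ f t x ↔ gaussCurvature s x = -μ := by
  have hU := (chartAt Plane x).open_target
  have hp := mem_chart_target Plane x
  have hS := contDiffOn_comp_chart_symm hs.smooth x
  have hfC := contDiffOn_comp_chart_symm hfs x
  obtain ⟨hg, hdet⟩ := metricCoeff_chart_pos hs hreg x
  have F := isTangentFrame_chart hq hs x hp hdet.ne'
  have C := hf.isConormal hs x hp
  have hfS : ∀ i, ∀ z ∈ (chartAt Plane x).target, lor (pd i (s ∘ (chartAt Plane x).symm) z)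
      ((f ∘ (chartAt Plane x).symm) z) = 0 := by
    intro i z hz
    have Cz := hf.isConormal hs x hz
    rw [lor_comm]
    fin_cases i
    · exact Cz.fu
    · exact Cz.fv
  have hK := gaussCurvatureCoord_mul_det (q := q) hU hS hfC (fun _ _ => (hs.mem _).1)
    (fun _ _ => (hs.mem _).2.1) hfS hp F C
  have hsym := lor_pd_normal_symm hU hS hfC hfS hp
  have dS := differentiableAt_of_contDiffOn hU hS hp
  have df := differentiableAt_of_contDiffOn hU hfC hp
  -- Differentiating `(f, s) = 0`, `(f, f) = 0` and `(f, q) = -1` shows `df` orthogonal to `s`, `f`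
  -- and `s + q`, so only its tangential components survive.
  have tang : ∀ j, ∃ a c : ℝ, pd j (f ∘ (chartAt Plane x).symm) (chartAt Plane x x) =
      a • pd 0 (s ∘ (chartAt Plane x).symm) (chartAt Plane x x) +
      c • pd 1 (s ∘ (chartAt Plane x).symm) (chartAt Plane x x) := by
    intro j
    have h1 := (pd_lor df dS j).symm.trans (pd_eq_zero hU (fun z _ => hf.incident _) j hp)
    rw [lor_comm ((f ∘ _) _), hfS j _ hp, add_zero, Function.comp_apply] at h1
    have h2 := (pd_lor df df j).symm.trans (pd_eq_zero hU (fun z _ => hf.null _) j hp)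
    rw [lor_comm ((f ∘ _) _), Function.comp_apply, add_self_eq_zero] at h2
    have hfq : ∀ z, lor (f z) q = -1 := fun z => by
      have := hf.scaled z
      rw [lor_add_right, hf.incident] at this
      linarith
    have h3 := (pd_lor df (differentiableAt_const q) j).symm.trans
      (pd_eq_zero hU (fun z _ => hfq _) j hp)
    rw [show pd j (fun _ : Plane => q) (chartAt Plane x x) = 0 by simp [pd], lor_comm _ (0 : R41),
      lor_zero_left, add_zero] at h3
    have e := F.expand C (pd j (f ∘ (chartAt Plane x).symm) (chartAt Plane x x))
    rw [lor_add_right, h1, h2, h3] at e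
    simp only [add_zero, zero_smul, sub_zero, zero_add] at e
    exact ⟨_, _, e⟩
  obtain ⟨a, c, h0⟩ := tang 0
  obtain ⟨b, d, h1⟩ := tang 1
  have hinj : Function.Injective (diffAt s x : Plane →L[ℝ] R41) := by
    rw [injective_iff_map_eq_zero]
    intro X hX
    by_contra hne
    have := hreg x X hne
    erw [hX] at this
    simp [lor_zero_left] at this
  have hT : diffAt t x = diffAt s x - diffAt f x := by rw [ht, diffAt_sub hs.smooth hfs]
  have hLX := linear_eq_smul_add (diffAt s x)
  have hNX := linear_eq_smul_add (diffAt f x)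
  have s0 := diffAt_single hs.smooth x 0
  have s1 := diffAt_single hs.smooth x 1
  have f0 := diffAt_single hfs x 0
  have f1 := diffAt_single hfs x 1
  rw [h0, ← s0, ← s1] at f0
  rw [h1, ← s0, ← s1] at f1
  have hB : ∀ i, lor (pd i (s ∘ (chartAt Plane x).symm) (chartAt Plane x x))
        (pd 0 (f ∘ (chartAt Plane x).symm) (chartAt Plane x x)) =
      a * metricCoeff (s ∘ (chartAt Plane x).symm) i 0 (chartAt Plane x x) +
      c * metricCoeff (s ∘ (chartAt Plane x).symm) i 1 (chartAt Plane x x) := by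
    intro i; rw [h0, lor_add_right, lor_smul_right, lor_smul_right]; rfl
  have hB' : ∀ i, lor (pd i (s ∘ (chartAt Plane x).symm) (chartAt Plane x x))
        (pd 1 (f ∘ (chartAt Plane x).symm) (chartAt Plane x x)) =
      b * metricCoeff (s ∘ (chartAt Plane x).symm) i 0 (chartAt Plane x x) +
      d * metricCoeff (s ∘ (chartAt Plane x).symm) i 1 (chartAt Plane x x) := by
    intro i; rw [h1, lor_add_right, lor_smul_right, lor_smul_right]; rfl
  have g10 : metricCoeff (s ∘ (chartAt Plane x).symm) 1 0 (chartAt Plane x x) =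
    metricCoeff (s ∘ (chartAt Plane x).symm) 0 1 (chartAt Plane x x) := lor_comm _ _
  rw [hB, hB', hB, hB', g10] at hK
  rw [hB, hB', g10] at hsym
  have main := exists_principal_iff_trace (diffAt s x) (diffAt f x) (diffAt t x) hinj hT a b c d
    _ _ _ μ (fun X => by
      rw [hNX X]
      erw [f0, f1]
      module) hLX hg hdet hsym
  refine Iff.trans main ?_
  change _ ↔ gaussCurvatureCoord _ _ = -μ
  constructor
  · intro h
    apply mul_right_cancel₀ hdet.ne'
    rw [hK]
    linear_combination -h * (metricCoeff (s ∘ (chartAt Plane x).symm) 0 0 (chartAt Plane x x) *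
        metricCoeff (s ∘ (chartAt Plane x).symm) 1 1 (chartAt Plane x x) -
      metricCoeff (s ∘ (chartAt Plane x).symm) 0 1 (chartAt Plane x x) *
        metricCoeff (s ∘ (chartAt Plane x).symm) 0 1 (chartAt Plane x x))
  · intro h
    rw [h] at hK
    apply mul_right_cancel₀ hdet.ne'
    linear_combination hK

theorem IsConormalMap.lor_diffAt_sphere {f : M → R41} (hf : IsConormalMap q s f)
    (hs : IsHorosphereCongruence q s) (hfs : ContMDiff 𝓘(ℝ, Plane) 𝓘(ℝ, R41) ∞ f) (x : M)
    (X : TangentSpace 𝓘(ℝ, Plane) x) : lor (diffAt f x X) (s x) = 0 := by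
  have := lor_diffAt_add hfs hs.smooth hf.incident x X
  rwa [hf.normal, add_zero] at this

theorem lor_diffAt_self {F : M → R41} (hF : ContMDiff 𝓘(ℝ, Plane) 𝓘(ℝ, R41) ∞ F) {c : ℝ}
    (h : ∀ x, lor (F x) (F x) = c) (x : M) (X : TangentSpace 𝓘(ℝ, Plane) x) :
    lor (diffAt F x X) (F x) = 0 := by
  have := lor_diffAt_add hF hF h x X
  rw [lor_comm (F x)] at this
  linarith

end Manifold

end

/-! ### Constant curvature and envelopes of Bryant type -/

theorem mainTheorem2 {M : Type*} [TopologicalSpace M] [ChartedSpace Plane M]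
    [IsManifold 𝓘(ℝ, Plane) ∞ M] (q : R41) (hq : q ∈ deSitter) (s : M → R41)
    (hs : IsHorosphereCongruence q s) (hreg : IsRegularCongruence s) (μ : ℝ) :
    (∀ x, gaussCurvature s x = -μ) ↔
      ∃ f t : M → R41, IsHyperbolicFront q f t ∧ IsBryantType μ f t ∧
        Envelops f s ∧ Envelops (hypGaussMap q f t) s := by
  have hqq : lor q q = 1 := hq
  have hss : ∀ x, lor (s x) (s x) = 1 := fun x => (hs.mem x).1
  have hsq : ∀ x, lor (s x) q = -1 := fun x => (hs.mem x).2.1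
  constructor
  · intro hK
    have hf := isConormalMap_conormalMap hq hs hreg
    have hfs := contMDiff_conormalMap hq hs hreg
    set f := conormalMap q s
    have hfq : ∀ x, lor (f x) q = -1 := fun x => by
      have := hf.scaled x
      rw [lor_add_right, hf.incident] at this
      linarith
    have hfl : ∀ x, f x ∈ lightCone := fun x =>
      ⟨fun h => by have := hfq x; rw [h, lor_zero_left] at this; linarith, hf.null x⟩
    have hdt := diffAt_sub hs.smooth hfs
    have hdfs := hf.lor_diffAt_sphere hs hfs
    have hh : hypGaussMap q f (fun x => s x - f x) = fun x => s x + q := by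
      funext x; simp only [hypGaussMap]; abel
    refine ⟨f, fun x => s x - f x, ?_, ?_, ⟨hfl, hf.incident, hdfs⟩, ?_⟩
    · refine ⟨hfs, hs.smooth.sub hfs, fun x => ⟨hfl x, hfq x⟩, fun x => ?_, fun x => ?_, fun x => ?_,
        fun x X => ?_, fun x X h1 h2 => ?_⟩
      · change lor _ _ = 1
        rw [lor_sub_left, lor_sub_right, lor_sub_right, hss, hf.null, lor_comm, hf.incident]
        ring
      · rw [lor_sub_left, hsq, hfq]; ring
      · rw [lor_sub_right, hf.incident, hf.null]; ring
      · rw [lor_sub_right, hdfs, lor_diffAt_self hfs hf.null]; ring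
      · by_contra hX
        have h3 : diffAt s x X = 0 := by
          rw [hdt, sub_apply, h1, sub_zero] at h2
          exact h2
        have := hreg x X hX
        rw [h3, lor_zero_left] at this
        exact lt_irrefl _ this
    · exact fun x => (isBryantAt_iff_gaussCurvature hq hs hreg hfs hf rfl μ x).2 (hK x)
    · rw [hh]
      have F := isTangentFrame_diffAt hq hs hreg
      refine ⟨fun x => ⟨add_ne_zero_of_congruence hs x, (F x).hh⟩, fun x => ?_, fun x X => ?_⟩
      · rw [lor_comm]; exact (F x).sh
      · rw [diffAt_add_const hs.smooth]
        exact lor_diffAt_self hs.smooth hss x X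
  · rintro ⟨f, t, hft, hB, hEf, hEh⟩
    have hf : IsConormalMap q s f := by
      refine ⟨hEf.incident, fun x X => ?_, fun x => (hft.lift_mem x).1.2, fun x => ?_⟩
      · have := lor_diffAt_add hft.smooth_lift hs.smooth hEf.incident x X
        rwa [hEf.tangent, zero_add] at this
      · rw [lor_add_right, hEf.incident, (hft.lift_mem x).2, zero_add]
    have hGs : ContMDiff 𝓘(ℝ, Plane) 𝓘(ℝ, R41) ∞ (hypGaussMap q f t) :=
      (contMDiff_const.add hft.smooth_lift).add hft.smooth_normal
    -- The hyperbolic Gauss map and `s + q` have the same products with every vector of the frame,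
    -- hence coincide; this determines `t`.
    have ht : t = fun x => s x - f x := by
      funext x
      have F := isTangentFrame_diffAt hq hs hreg x
      have C : IsConormal (s x) (diffAt s x (EuclideanSpace.single 0 1 : Plane))
          (diffAt s x (EuclideanSpace.single 1 1 : Plane)) (s x + q) (f x) :=
        ⟨hf.incident x, hf.normal x _, hf.normal x _, hf.null x, hf.scaled x⟩
      have hGX : ∀ X, lor (hypGaussMap q f t x) (diffAt s x X) = 0 := fun X => by
        have := lor_diffAt_add hGs hs.smooth hEh.incident x X
        rwa [hEh.tangent, zero_add] at this
      have hGq : lor (hypGaussMap q f t x) q = 0 := by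
        rw [hypGaussMap, lor_add_left, lor_add_left, hqq, (hft.lift_mem x).2, hft.normal_orth]
        ring
      have hGf : lor (hypGaussMap q f t x) (f x) = -1 := by
        rw [hypGaussMap, lor_add_left, lor_add_left, lor_comm q, (hft.lift_mem x).2, hf.null,
          lor_comm, hft.incident]
        ring
      have hz : hypGaussMap q f t x - (s x + q) = 0 := by
        apply F.eq_zero C
        · rw [lor_sub_left, hEh.incident, lor_comm, F.sh, sub_zero]
        · rw [lor_sub_left, F.hu, sub_zero]; exact hGX _
        · rw [lor_sub_left, F.hv, sub_zero]; exact hGX _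
        · rw [lor_sub_left, F.hh, lor_add_right, hEh.incident, hGq]; ring
        · rw [lor_sub_left, hGf, lor_comm, C.fh]; ring
      have : t x - (s x - f x) = hypGaussMap q f t x - (s x + q) := by
        simp only [hypGaussMap]; abel
      rw [← sub_eq_zero, this, hz]
    exact fun x => (isBryantAt_iff_gaussCurvature hq hs hreg hft.smooth_lift hf ht μ x).1 (hB x)
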